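/- Fix an integer $n\ge 2$, let $I=[0,1]$, and let $(X,x)$ be a based topological space. An $n$-loop is a continuous map $f:I^n\to X$ with $f(\partial I^n)=\{x\}$; the set of $n$-loops is $\Omega^n(X,x)$. An $n$-cube is a set $\prod_{i=1}^n[a_i,b_i]\subseteq I^n$ with $a_i<b_i$ for all $i$. Let $K\subseteq\mathbb N$ be non-empty (finite or infinite). An $n$-domain over $K$ is a family $\mathscr R=\{R_k\}_{k\in K}$ of $n$-cubes in $I^n$ whose interiors are pairwise disjoint. A $K$-sequence is a family $\{f_k\}_{k\in K}$ in $\Omega^n(X,x)$ that, if $K$ is infinite, is null at $x$: every neighborhood of $x$ contains $\operatorname{Im}(f_k)$ for all but finitely many $k\in K$. The $\mathscr R$-concatenation $\prod_{\mathscr R}f_k\in\Omega^n(X,x)$ is the $n$-loop whose restriction to $R_k$ is $f_k\circ L_{R_k}$, where $L_{R_k}:R_k\to I^n$ is the homeomorphism that is increasing and affine in each coordinate, and which maps $I^n\setminus\bigcup_{k}R_k$ to $x$. Theorem. Let $\mathscr R=\{R_k\}_{k\in K}$ and $\mathscr S=\{S_k\}_{k\in K}$ be $n$-domains over $K$ and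 let $\{f_k\}_{k\in K}$ be a $K$-sequence in $\Omega^n(X,x)$. Then there is a homotopy relative to $\partial I^n$ from $\prod_{\mathscr R}f_k$ to $\prod_{\mathscr S}f_k$ whose image lies in $\bigcup_{k\in K}\operatorname{Im}(f_k)$. Moreover, for every finite set $F\subseteq K$ such that $R_k=S_k$ for all $k\in F$ and any two points of $I^n\setminus\bigcup_{k\in F}R_k$ can be joined by a path in $I^n\setminus\bigcup_{k\in F}R_k$, such a homotopy can be chosen that is in addition constant on $\bigcup_{k\in F}R_k$. -/

import Mathlib

open scoped unitInterval Topology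

/-- An `n`-cube in `I^n`: a product of nondegenerate closed intervals `[lo i, hi i]` in `I`. -/
@[ext]
structure NCube (n : ℕ) where
  lo : Fin n → I
  hi : Fin n → I
  lo_lt_hi : ∀ i, lo i < hi i

namespace NCube

variable {n : ℕ}

/-- The underlying subset `∏ i, [lo i, hi i]` of `I^n`. -/
def toSet (R : NCube n) : Set (Fin n → I) := {b | ∀ i, R.lo i ≤ b i ∧ b i ≤ R.hi i}

/-- The open box `∏ i, (lo i, hi i)`. -/
def openBox (R : NCube n) : Set (Fin n → I) := {b | ∀ i, R.lo i < b i ∧ b i < R.hi i}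

/-- The canonical map from `R` to `I^n`, increasing and affine in each coordinate, extended to all
of `I^n` by clamping each coordinate to `[0, 1]`. -/
noncomputable def rescale (R : NCube n) (b : Fin n → I) : Fin n → I := fun i =>
  Set.projIcc (0 : ℝ) 1 zero_le_one (((b i : ℝ) - R.lo i) / ((R.hi i : ℝ) - R.lo i))

/-- On `R`, no clamping takes place. -/
theorem rescale_coe (R : NCube n) {b : Fin n → I} (hb : b ∈ R.toSet) (i : Fin n) :
    ((R.rescale b i : I) : ℝ) = ((b i : ℝ) - R.lo i) / ((R.hi i : ℝ) - R.lo i) := by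
  have h1 : (R.lo i : ℝ) ≤ b i := (hb i).1
  have h2 : (b i : ℝ) ≤ R.hi i := (hb i).2
  have h3 : (R.lo i : ℝ) < R.hi i := R.lo_lt_hi i
  have h4 : ((b i : ℝ) - R.lo i) / ((R.hi i : ℝ) - R.lo i) ∈ Set.Icc (0 : ℝ) 1 :=
    ⟨div_nonneg (by linarith) (by linarith), (div_le_one (by linarith)).2 (by linarith)⟩
  unfold rescale
  rw [Set.projIcc_of_mem _ h4]

theorem continuous_rescale (R : NCube n) : Continuous R.rescale := by
  refine continuous_pi fun i => continuous_projIcc.comp ?_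
  exact ((continuous_subtype_val.comp (continuous_apply i)).sub continuous_const).div_const _

theorem rescale_mem_boundary (R : NCube n) {b : Fin n → I} (hb : b ∉ R.openBox) :
    R.rescale b ∈ Cube.boundary (Fin n) := by
  simp only [openBox, Set.mem_ofPred_eq, not_forall] at hb
  obtain ⟨i, hi⟩ := hb
  have h3 : (R.lo i : ℝ) < R.hi i := R.lo_lt_hi i
  refine ⟨i, ?_⟩
  by_cases h : R.lo i < b i
  · right
    have h5 : (R.hi i : ℝ) ≤ b i := not_lt.1 fun h' => hi ⟨h, h'⟩
    exact Set.projIcc_of_right_le _ ((one_le_div (by linarith)).2 (by linarith))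
  · left
    have h5 : (b i : ℝ) ≤ R.lo i := not_lt.1 h
    exact Set.projIcc_of_le_left _ (div_nonpos_of_nonpos_of_nonneg (by linarith) (by linarith))

theorem openBox_subset_toSet (R : NCube n) : R.openBox ⊆ R.toSet :=
  fun _ hb i => ⟨(hb i).1.le, (hb i).2.le⟩

theorem openBox_subset_interior (R : NCube n) : R.openBox ⊆ interior R.toSet := by
  refine interior_maximal R.openBox_subset_toSet ?_
  have : R.openBox = Set.univ.pi fun i => Set.Ioo (R.lo i) (R.hi i) := by
    ext b; simp [openBox]
  rw [this]
  exact isOpen_set_pi Set.finite_univ fun i _ => isOpen_Ioo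

theorem notMem_openBox_of_mem_boundary (R : NCube n) {b : Fin n → I}
    (hb : b ∈ Cube.boundary (Fin n)) : b ∉ R.openBox := by
  rintro h
  obtain ⟨i, hi | hi⟩ := hb
  · exact absurd (h i).1 (by rw [hi]; exact not_lt.2 unitInterval.nonneg')
  · exact absurd (h i).2 (by rw [hi]; exact not_lt.2 unitInterval.le_one')

end NCube

/-- An `n`-domain over `K`: a `K`-indexed family of `n`-cubes with pairwise disjoint interiors. -/
structure NDomain (n : ℕ) (K : Type*) where
  cube : K → NCube n
  disjoint_interior :
    ∀ j k, j ≠ k → Disjoint (interior (cube j).toSet) (interior (cube k).toSet)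

/-- A family of `n`-loops is null at `x` if every neighborhood of `x` contains the images of all
but finitely many members. -/
def IsNullAt {n : ℕ} {X : Type*} [TopologicalSpace X] {x : X} {K : Type*}
    (f : K → GenLoop (Fin n) X x) : Prop :=
  ∀ U ∈ 𝓝 x, {k | ¬ Set.range (f k) ⊆ U}.Finite

/-- A `K`-sequence of `n`-loops: null at `x` when `K` is infinite. -/
def IsKSequence {n : ℕ} {X : Type*} [TopologicalSpace X] {x : X} {K : Type*}
    (f : K → GenLoop (Fin n) X x) : Prop :=
  Finite K ∨ (Infinite K ∧ IsNullAt f)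

theorem IsKSequence.isNullAt {n : ℕ} {X : Type*} [TopologicalSpace X] {x : X} {K : Type*}
    {f : K → GenLoop (Fin n) X x} (hf : IsKSequence f) : IsNullAt f := by
  rcases hf with h | h
  · exact fun U _ => Set.toFinite _
  · exact h.2

namespace NDomain

variable {n : ℕ} {X : Type*} [TopologicalSpace X] {x : X} {K : Type*}

open Classical in
/-- The function `f k ∘ L` on the cube `k`, where `L` is the canonical map onto `I^n`, and `x`
off the union of the cubes. -/
noncomputable def concatFun (R : NDomain n K) (f : K → GenLoop (Fin n) X x)
    (b : Fin n → I) : X :=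
  if h : ∃ k, b ∈ (R.cube k).toSet then f h.choose ((R.cube h.choose).rescale b) else x

theorem eq_of_mem_openBox (R : NDomain n K) {b : Fin n → I} {j k : K}
    (hj : b ∈ (R.cube j).openBox) (hk : b ∈ (R.cube k).toSet) : j = k := by
  by_contra hne
  have h : ∀ i, ∃ c : I, max ((R.cube j).lo i) ((R.cube k).lo i) < c ∧
      c < min ((R.cube j).hi i) ((R.cube k).hi i) := fun i => by
    refine exists_between (max_lt (lt_min ((R.cube j).lo_lt_hi i) ?_)
      (lt_min ?_ ((R.cube k).lo_lt_hi i)))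
    · exact (hj i).1.trans_le (hk i).2
    · exact (hk i).1.trans_lt (hj i).2
  choose c hc1 hc2 using h
  refine Set.disjoint_left.1 (R.disjoint_interior j k hne)
    ((R.cube j).openBox_subset_interior (a := c) ?_)
    ((R.cube k).openBox_subset_interior (a := c) ?_)
  · exact fun i => ⟨(max_lt_iff.1 (hc1 i)).1, (lt_min_iff.1 (hc2 i)).1⟩
  · exact fun i => ⟨(max_lt_iff.1 (hc1 i)).2, (lt_min_iff.1 (hc2 i)).2⟩

/-- The value on the cube `k` is `f k ∘ L`, whichever cube was chosen. -/
theorem concatFun_of_mem (R : NDomain n K) (f : K → GenLoop (Fin n) X x) {b : Fin n → I} {k : K}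
    (hb : b ∈ (R.cube k).toSet) : R.concatFun f b = f k ((R.cube k).rescale b) := by
  have h : ∃ k, b ∈ (R.cube k).toSet := ⟨k, hb⟩
  rw [concatFun, dif_pos h]
  by_cases hjk : h.choose = k
  · rw [hjk]
  · rw [GenLoop.boundary (f _) _ ((R.cube _).rescale_mem_boundary fun h' => hjk
        (R.eq_of_mem_openBox h' hb)),
      GenLoop.boundary (f _) _ ((R.cube _).rescale_mem_boundary fun h' => hjk
        (R.eq_of_mem_openBox h' h.choose_spec).symm)]

theorem concatFun_of_notMem (R : NDomain n K) (f : K → GenLoop (Fin n) X x) {b : Fin n → I}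
    (hb : ∀ k, b ∉ (R.cube k).toSet) : R.concatFun f b = x :=
  dif_neg fun ⟨k, hk⟩ => hb k hk

theorem concatFun_of_mem_boundary (R : NDomain n K) (f : K → GenLoop (Fin n) X x)
    {b : Fin n → I} (hb : b ∈ Cube.boundary (Fin n)) : R.concatFun f b = x := by
  by_cases h : ∃ k, b ∈ (R.cube k).toSet
  · obtain ⟨k, hk⟩ := h
    rw [R.concatFun_of_mem f hk]
    exact GenLoop.boundary (f k) _
      ((R.cube k).rescale_mem_boundary ((R.cube k).notMem_openBox_of_mem_boundary hb))
  · exact R.concatFun_of_notMem f (not_exists.1 h)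

theorem concatFun_eq_or (R : NDomain n K) (f : K → GenLoop (Fin n) X x) (b : Fin n → I) :
    R.concatFun f b = x ∨ ∃ k, R.concatFun f b = f k ((R.cube k).rescale b) := by
  by_cases h : ∃ k, b ∈ (R.cube k).toSet
  · exact Or.inr ⟨h.choose, R.concatFun_of_mem f h.choose_spec⟩
  · exact Or.inl (R.concatFun_of_notMem f (not_exists.1 h))

theorem rescale_eq_or (R : NDomain n K) (f : K → GenLoop (Fin n) X x) (b : Fin n → I) (k : K) :
    f k ((R.cube k).rescale b) = x ∨ f k ((R.cube k).rescale b) = R.concatFun f b := by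
  by_cases h : b ∈ (R.cube k).openBox
  · exact Or.inr (R.concatFun_of_mem f ((R.cube k).openBox_subset_toSet h)).symm
  · exact Or.inl (GenLoop.boundary (f k) _ ((R.cube k).rescale_mem_boundary h))

theorem continuous_concatFun (R : NDomain n K) {f : K → GenLoop (Fin n) X x}
    (hf : IsKSequence f) : Continuous (R.concatFun f) := by
  have hc : ∀ k, Continuous fun b => f k ((R.cube k).rescale b) := fun k =>
    (f k).1.continuous.comp (R.cube k).continuous_rescale
  rw [continuous_def]
  intro U hU
  by_cases hx : x ∈ U
  · have : R.concatFun f ⁻¹' U =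
        ⋂ k ∈ {k | ¬ Set.range (f k) ⊆ U}, (fun b => f k ((R.cube k).rescale b)) ⁻¹' U := by
      ext b
      simp only [Set.mem_iInter, Set.mem_preimage]
      constructor
      · intro hb k _
        rcases R.rescale_eq_or f b k with h | h <;> rw [h] <;> assumption
      · intro hb
        rcases R.concatFun_eq_or f b with h | ⟨k, h⟩
        · rwa [h]
        · rw [h]
          by_cases hk : Set.range (f k) ⊆ U
          · exact hk ⟨_, rfl⟩
          · exact hb k hk
    rw [this]
    exact (hf.isNullAt U (hU.mem_nhds hx)).isOpen_biInter fun k _ => hU.preimage (hc k)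
  · have : R.concatFun f ⁻¹' U = ⋃ k, (fun b => f k ((R.cube k).rescale b)) ⁻¹' U := by
      ext b
      simp only [Set.mem_iUnion, Set.mem_preimage]
      constructor
      · intro hb
        rcases R.concatFun_eq_or f b with h | ⟨k, h⟩
        · rw [h] at hb
          exact absurd hb hx
        · exact ⟨k, h ▸ hb⟩
      · rintro ⟨k, hk⟩
        rcases R.rescale_eq_or f b k with h | h
        · rw [h] at hk
          exact absurd hk hx
        · rwa [← h]
    rw [this]
    exact isOpen_iUnion fun k => hU.preimage (hc k)

/-- The `R`-concatenation of a `K`-sequence of `n`-loops, as an `n`-loop. -/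
noncomputable def concat (R : NDomain n K) (f : K → GenLoop (Fin n) X x) (hf : IsKSequence f) :
    GenLoop (Fin n) X x :=
  ⟨⟨R.concatFun f, R.continuous_concatFun hf⟩, fun _ hb => R.concatFun_of_mem_boundary f hb⟩

/-- The union of the cubes of `R` with index in `F`. -/
def unionOver (R : NDomain n K) (F : Finset K) : Set (Fin n → I) :=
  ⋃ k ∈ F, (R.cube k).toSet

end NDomain

/-! An `n`-domain is a point of a configuration space of separated boxes, a subset of a product over
`K` of corner coordinates. Since `f` is null at `x`, the concatenation depends continuously on this
point in the product topology (`continuous_concatFun_family`). It is therefore enough to join `R` to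
`S` by a path of configurations fixing the boxes in `F`.

The boxes are put in place one at a time. In dimension at least two, a box can be driven along a
coordinate direction past the movable ones, which are cut down and compressed sideways to clear the
way (`exists_joinedIn_update`). Chaining such moves carries it anywhere in the connected region free
of the placed boxes (`exists_joinedIn_of_isPreconnected`). It is then shrunk to a tiny cube inside
its target; removing that cube keeps the free region connected (`IsPreconnected.diff_closedBall`),
so the process continues.

Each box is frozen after finitely many stages, so the infinite concatenation of these paths
converges in the product topology (`joinedIn_of_eventually_const`). In the limit every box lies
inside its target, and a straight line expands it to `S`. -/

/-- Two boxes, given by their lower and upper corners, are separated by a coordinate hyperplane. -/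
def BoxSep {n : ℕ} (A B : (Fin n → ℝ) × (Fin n → ℝ)) : Prop :=
  ∃ i, A.2 i ≤ B.1 i ∨ B.2 i ≤ A.1 i

/-- A nondegenerate box contained in the unit cube. -/
def IsUnitBox {n : ℕ} (A : (Fin n → ℝ) × (Fin n → ℝ)) : Prop :=
  ∀ i, 0 ≤ A.1 i ∧ A.1 i < A.2 i ∧ A.2 i ≤ 1

/-- The box `A` is contained in the box `B`. -/
def BoxLE {n : ℕ} (A B : (Fin n → ℝ) × (Fin n → ℝ)) : Prop :=
  ∀ i, B.1 i ≤ A.1 i ∧ A.2 i ≤ B.2 i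

/-- The point `p` lies in the interior of the box `A`. -/
def BoxMem {n : ℕ} (p : Fin n → ℝ) (A : (Fin n → ℝ) × (Fin n → ℝ)) : Prop :=
  ∀ i, A.1 i < p i ∧ p i < A.2 i

/-- The space of families of pairwise separated boxes in the unit cube, with the boxes indexed by
`G` prescribed. -/
def boxConf {n : ℕ} {K : Type*} (G : Set K) (D₀ : K → (Fin n → ℝ) × (Fin n → ℝ)) :
    Set (K → (Fin n → ℝ) × (Fin n → ℝ)) :=
  {D | (∀ k, IsUnitBox (D k)) ∧ (∀ j k, j ≠ k → BoxSep (D j) (D k)) ∧ ∀ j ∈ G, D j = D₀ j}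

/-! ### Straight-line moves between configurations -/

section

variable {n : ℕ} {K : Type*} {G : Set K} {D₀ D D' : K → (Fin n → ℝ) × (Fin n → ℝ)}

theorem BoxSep.symm {A B : (Fin n → ℝ) × (Fin n → ℝ)} (h : BoxSep A B) : BoxSep B A := by
  obtain ⟨i, hi⟩ := h
  exact ⟨i, hi.symm⟩

theorem BoxSep.mono {A B A' B' : (Fin n → ℝ) × (Fin n → ℝ)} (h : BoxSep A B)
    (hA : BoxLE A' A) (hB : BoxLE B' B) : BoxSep A' B' := by
  obtain ⟨i, hi | hi⟩ := h
  · exact ⟨i, Or.inl ((hA i).2.trans (hi.trans (hB i).1))⟩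
  · exact ⟨i, Or.inr ((hB i).2.trans (hi.trans (hA i).1))⟩

theorem BoxLE.refl (A : (Fin n → ℝ) × (Fin n → ℝ)) : BoxLE A A := fun _ => ⟨le_rfl, le_rfl⟩

theorem BoxLE.trans {A B C : (Fin n → ℝ) × (Fin n → ℝ)} (h : BoxLE A B) (h' : BoxLE B C) :
    BoxLE A C := fun i => ⟨(h' i).1.trans (h i).1, (h i).2.trans (h' i).2⟩

/-- Two configurations in which every pair of boxes is separated by the same coordinate, in the
same order, are joined by the straight line path. -/
theorem joinedIn_boxConf_of_common_sep (hD : D ∈ boxConf G D₀) (hD' : ∀ k, IsUnitBox (D' k))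
    (hG : ∀ j ∈ G, D' j = D j)
    (hsep : ∀ j k, j ≠ k → ∃ i, ((D j).2 i ≤ (D k).1 i ∧ (D' j).2 i ≤ (D' k).1 i) ∨
      ((D k).2 i ≤ (D j).1 i ∧ (D' k).2 i ≤ (D' j).1 i)) :
    JoinedIn (boxConf G D₀) D D' := by
  -- Separation alone is not a convex condition, because the separating coordinate may vary; with
  -- coordinate and order fixed it is a linear inequality, which convex combinations preserve.
  refine JoinedIn.of_segment_subset ?_
  rintro _ ⟨a, b, ha, hb, hab, rfl⟩
  refine ⟨fun k i => ?_, fun j k hjk => ?_, fun j hj => ?_⟩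
  · obtain ⟨h1, h2, h3⟩ := hD.1 k i
    obtain ⟨h4, h5, h6⟩ := hD' k i
    simp only [Pi.add_apply, Pi.smul_apply, Prod.fst_add, Prod.smul_fst, Prod.snd_add,
      Prod.smul_snd, smul_eq_mul]
    refine ⟨by positivity, ?_, ?_⟩
    · rcases ha.eq_or_lt with rfl | ha
      · obtain rfl : b = 1 := by linarith
        simpa using h5
      · have := mul_lt_mul_of_pos_left h2 ha
        have := mul_le_mul_of_nonneg_left h5.le hb
        linarith
    · have := mul_le_mul_of_nonneg_left h3 ha
      have := mul_le_mul_of_nonneg_left h6 hb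
      linarith
  · obtain ⟨i, ⟨h1, h2⟩ | ⟨h1, h2⟩⟩ := hsep j k hjk
    · refine ⟨i, Or.inl ?_⟩
      simp only [Pi.add_apply, Pi.smul_apply, Prod.fst_add, Prod.smul_fst, Prod.snd_add,
        Prod.smul_snd, smul_eq_mul]
      gcongr
    · refine ⟨i, Or.inr ?_⟩
      simp only [Pi.add_apply, Pi.smul_apply, Prod.fst_add, Prod.smul_fst, Prod.snd_add,
        Prod.smul_snd, smul_eq_mul]
      gcongr
  · rw [← hD.2.2 j hj]
    simp only [Pi.add_apply, Pi.smul_apply, hG j hj]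
    rw [← add_smul, hab, one_smul]

/-- Shrinking the boxes of a configuration. -/
theorem joinedIn_boxConf_of_boxLE (hD : D ∈ boxConf G D₀) (hD' : ∀ k, IsUnitBox (D' k))
    (hG : ∀ j ∈ G, D' j = D j) (hle : ∀ k, BoxLE (D' k) (D k)) :
    JoinedIn (boxConf G D₀) D D' := by
  refine joinedIn_boxConf_of_common_sep hD hD' hG fun j k hjk => ?_
  obtain ⟨i, h | h⟩ := hD.2.1 j k hjk
  · exact ⟨i, Or.inl ⟨h, ((hle j i).2.trans h).trans (hle k i).1⟩⟩
  · exact ⟨i, Or.inr ⟨h, ((hle k i).2.trans h).trans (hle j i).1⟩⟩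

/-! ### Moving one box past the others -/

/-- Squeezing of the `i`-th coordinate towards `a` by the factor `θ`. -/
noncomputable def squeezeCoord (i : Fin n) (a θ : ℝ) (y : Fin n → ℝ) : Fin n → ℝ :=
  Function.update y i (a + (y i - a) * θ)

/-- A box can be moved inside a box `B` which avoids the prescribed boxes, so as to contain a
point obtained by changing one coordinate. -/
theorem exists_joinedIn_update [DecidableEq K] {i i' : Fin n} (hii : i' ≠ i)
    (hD : D ∈ boxConf G D₀)
    {k : K} (hk : k ∉ G) {B : (Fin n → ℝ) × (Fin n → ℝ)} (hB : IsUnitBox B)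
    (hBG : ∀ j ∈ G, BoxSep (D j) B) {p : Fin n → ℝ} (hpD : BoxMem p (D k)) (hpB : BoxMem p B)
    {c : ℝ} (hc : B.1 i < c ∧ c < B.2 i) :
    ∃ D', JoinedIn (boxConf G D₀) D D' ∧ BoxMem (Function.update p i c) (D' k) := by
  -- The tube `T` is `C = D k ∩ B` stretched across `B` in direction `i`. Obstacles in it are
  -- compressed in the second direction `i'` below a level `m`, and the slice of `C` above `m` then
  -- slides over them along the tube.
  classical
  -- the tube, and the part of it in `D k`
  set C : (Fin n → ℝ) × (Fin n → ℝ) :=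
    (fun l => max (B.1 l) ((D k).1 l), fun l => min (B.2 l) ((D k).2 l)) with hC
  set T : (Fin n → ℝ) × (Fin n → ℝ) :=
    (Function.update C.1 i (B.1 i), Function.update C.2 i (B.2 i)) with hT
  have hpC : BoxMem p C := fun l =>
    ⟨max_lt (hpB l).1 (hpD l).1, lt_min (hpB l).2 (hpD l).2⟩
  have hCB : BoxLE C B := fun l => ⟨le_max_left _ _, min_le_left _ _⟩
  have hCD : BoxLE C (D k) := fun l => ⟨le_max_right _ _, min_le_right _ _⟩
  have hTi : T.1 i = B.1 i ∧ T.2 i = B.2 i := by simp [hT]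
  have hTl : ∀ l, l ≠ i → T.1 l = C.1 l ∧ T.2 l = C.2 l := fun l hl => by simp [hT, hl]
  have hTB : BoxLE T B := fun l => by
    by_cases hl : l = i
    · subst hl; rw [hTi.1, hTi.2]; exact ⟨le_rfl, le_rfl⟩
    · rw [(hTl l hl).1, (hTl l hl).2]; exact hCB l
  have hCT : BoxLE C T := fun l => by
    by_cases hl : l = i
    · subst hl; rw [hTi.1, hTi.2]; exact hCB l
    · rw [(hTl l hl).1, (hTl l hl).2]; exact ⟨le_rfl, le_rfl⟩
  -- Any level strictly between the lower face of `C` and `p` would do: `p` stays above it and room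
  -- remains below.
  set m := (C.1 i' + p i') / 2 with hm
  have hm1 : C.1 i' < m := by have := (hpC i').1; linarith
  have hm2 : m < p i' := by have := (hpC i').1; linarith
  have hm3 : m < C.2 i' := hm2.trans (hpC i').2
  set Cup : (Fin n → ℝ) × (Fin n → ℝ) := (Function.update C.1 i' m, C.2) with hCup
  set Tup : (Fin n → ℝ) × (Fin n → ℝ) := (Function.update T.1 i' m, T.2) with hTup
  have hCupC : BoxLE Cup C := fun l => by
    refine ⟨?_, le_rfl⟩
    by_cases hl : l = i'
    · subst hl; simpa [hCup] using hm1.le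
    · simp [hCup, hl]
  have hTupT : BoxLE Tup T := fun l => by
    refine ⟨?_, le_rfl⟩
    by_cases hl : l = i'
    · subst hl; simpa [hTup, (hTl _ hii).1] using hm1.le
    · simp [hTup, hl]
  have hpCup : BoxMem p Cup := fun l => by
    refine ⟨?_, (hpC l).2⟩
    by_cases hl : l = i'
    · subst hl; simpa [hCup] using hm2
    · simpa [hCup, hl] using (hpC l).1
  have hpTup : BoxMem (Function.update p i c) Tup := fun l => by
    by_cases hl : l = i
    · subst hl
      simp only [hTup, Function.update_self, Function.update_of_ne hii.symm, hTi.1, hTi.2]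
      exact hc
    · rw [Function.update_of_ne hl]
      refine ⟨?_, by simpa [hTup, (hTl l hl).2] using (hpC l).2⟩
      by_cases hl' : l = i'
      · subst hl'; simpa [hTup] using hm2
      · simpa [hTup, hl', (hTl l hl).1] using (hpC l).1
  have unit_of : ∀ {A : (Fin n → ℝ) × (Fin n → ℝ)} {q : Fin n → ℝ}, BoxLE A B → BoxMem q A →
      IsUnitBox A := fun {A q} hA hq l =>
    ⟨(hB l).1.trans (hA l).1, (hq l).1.trans (hq l).2, (hA l).2.trans (hB l).2.2⟩
  have hTlt : ∀ l, T.1 l < T.2 l := fun l =>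
    ((hTupT l).1.trans_lt (hpTup l).1).trans_le ((hpTup l).2.le.trans (hTupT l).2)
  -- the part of `D j` in the tube
  set Q : K → (Fin n → ℝ) × (Fin n → ℝ) := fun j =>
    (fun l => max (T.1 l) ((D j).1 l), fun l => min (T.2 l) ((D j).2 l)) with hQ
  have hQT : ∀ j, BoxLE (Q j) T := fun j l => ⟨le_max_left _ _, min_le_left _ _⟩
  have hQD : ∀ j, BoxLE (Q j) (D j) := fun j l => ⟨le_max_right _ _, min_le_right _ _⟩
  have hQlt : ∀ j, ¬ BoxSep (D j) T → ∀ l, (Q j).1 l < (Q j).2 l := fun j hj l => by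
    simp only [BoxSep, not_exists, not_or, not_le] at hj
    exact max_lt (lt_min (hTlt l) (hj l).1) (lt_min (hj l).2 (hD.1 j l).2.1)
  have hQunit : ∀ j, ¬ BoxSep (D j) T → IsUnitBox (Q j) := fun j hj l =>
    ⟨(hD.1 j l).1.trans (hQD j l).1, hQlt j hj l, (hQD j l).2.trans (hD.1 j l).2.2⟩
  -- inside the tube, the other boxes are separated from `C` by the `i`-th coordinate
  have hQC : ∀ j, j ≠ k → ¬ BoxSep (D j) T →
      (Q j).2 i ≤ C.1 i ∨ C.2 i ≤ (Q j).1 i := fun j hjk hj => by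
    obtain ⟨l, hl⟩ := hD.2.1 j k hjk
    have h1 := hQlt j hj l
    by_cases hli : l = i
    · subst hli
      rcases hl with hl | hl
      · exact Or.inl ((hQD j l).2.trans (hl.trans (hCD l).1))
      · exact Or.inr ((hCD l).2.trans (hl.trans (hQD j l).1))
    -- In a direction other than `i` the tube is no wider than `C`, so separation there would make
    -- `Q j` degenerate.
    · have h2 := hQT j l
      rw [(hTl l hli).1, (hTl l hli).2] at h2
      exfalso
      rcases hl with hl | hl
      · exact absurd h1 (not_lt.2 ((hQD j l).2.trans (hl.trans ((hCD l).1.trans h2.1))))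
      · exact absurd h1 (not_lt.2 (h2.2.trans ((hCD l).2.trans (hl.trans (hQD j l).1))))
  set a := T.1 i' with ha
  -- The squeeze fixes the bottom `a` of the tube and sends its top to `m`.
  set θ := (m - a) / (T.2 i' - a) with hθ
  have ham : a < m := by rw [ha, (hTl _ hii).1]; exact hm1
  have hmT : m < T.2 i' := by rw [(hTl _ hii).2]; exact hm3
  have hθ0 : 0 < θ := div_pos (by linarith) (by linarith)
  have hθ1 : θ ≤ 1 := (div_le_one (by linarith)).2 (by linarith)
  have hθm : (T.2 i' - a) * θ = m - a := by
    rw [hθ]; field_simp [show T.2 i' - a ≠ 0 by linarith]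
  set sq := squeezeCoord i' a θ with hsq
  have sq_ne : ∀ y l, l ≠ i' → sq y l = y l := fun y l hl => by simp [hsq, squeezeCoord, hl]
  have sq_self : ∀ y, sq y i' = a + (y i' - a) * θ := fun y => by simp [hsq, squeezeCoord]
  have sq_mono : ∀ {y z : Fin n → ℝ} l, y l ≤ z l → sq y l ≤ sq z l := fun {y z} l h => by
    by_cases hl : l = i'
    · subst hl; rw [sq_self, sq_self]; gcongr
    · rw [sq_ne _ _ hl, sq_ne _ _ hl]; exact h
  have sq_lt : ∀ {y z : Fin n → ℝ} l, y l < z l → sq y l < sq z l := fun {y z} l h => by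
    by_cases hl : l = i'
    · subst hl; rw [sq_self, sq_self]; gcongr
    · rw [sq_ne _ _ hl, sq_ne _ _ hl]; exact h
  set Q' : K → (Fin n → ℝ) × (Fin n → ℝ) := fun j => (sq (Q j).1, sq (Q j).2) with hQ'
  have hQm : ∀ j, (Q' j).2 i' ≤ m := fun j => by
    have := mul_le_mul_of_nonneg_right (sub_le_sub_right (hQT j i').2 a) hθ0.le
    simp only [hQ', sq_self]
    linarith
  have hQ'T : ∀ j, BoxLE (Q' j) T := fun j l => by
    by_cases hl : l = i'
    · subst hl
      refine ⟨?_, (hQm j).trans hmT.le⟩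
      have := mul_nonneg (sub_nonneg.2 (hQT j l).1) hθ0.le
      simp only [hQ', sq_self]
      linarith
    · simp only [hQ', sq_ne _ _ hl]; exact hQT j l
  have hQ'unit : ∀ j, ¬ BoxSep (D j) T → IsUnitBox (Q' j) := fun j hj l =>
    ⟨(hB l).1.trans ((BoxLE.trans (hQ'T j) hTB) l).1, sq_lt l (hQlt j hj l),
      ((BoxLE.trans (hQ'T j) hTB) l).2.trans (hB l).2.2⟩
  have hGT : ∀ j ∈ G, BoxSep (D j) T := fun j hj => (hBG j hj).mono (BoxLE.refl _) hTB
  have hGk : ∀ j ∈ G, j ≠ k := fun j hj h => hk (h ▸ hj)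
  -- Three stages: shrink, compress the obstacles below `m`, stretch box `k` along the tube. Boxes
  -- separated from the tube, among them all prescribed ones, never move.
  set D1 : K → (Fin n → ℝ) × (Fin n → ℝ) := fun j =>
    if j = k then Cup else if BoxSep (D j) T then D j else Q j with hD1
  set D2 : K → (Fin n → ℝ) × (Fin n → ℝ) := fun j =>
    if j = k then Cup else if BoxSep (D j) T then D j else Q' j with hD2
  set D3 : K → (Fin n → ℝ) × (Fin n → ℝ) := fun j =>
    if j = k then Tup else if BoxSep (D j) T then D j else Q' j with hD3
  have hCupB := BoxLE.trans hCupC hCB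
  have hCupT := BoxLE.trans hCupC hCT
  have j1 : JoinedIn (boxConf G D₀) D D1 := by
    refine joinedIn_boxConf_of_boxLE hD (fun j => ?_) (fun j hj => ?_) fun j => ?_
    · simp only [hD1]
      split_ifs with h1 h2
      exacts [unit_of hCupB hpCup, hD.1 j, hQunit j h2]
    · simp only [hD1]
      rw [if_neg (hGk j hj), if_pos (hGT j hj)]
    · simp only [hD1]
      split_ifs with h1 h2
      exacts [h1 ▸ BoxLE.trans hCupC hCD, BoxLE.refl _, hQD j]
  have j2 : JoinedIn (boxConf G D₀) D1 D2 := by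
    refine joinedIn_boxConf_of_common_sep j1.target_mem (fun j => ?_) (fun j hj => ?_) ?_
    · simp only [hD2]
      split_ifs with h1 h2
      exacts [unit_of hCupB hpCup, hD.1 j, hQ'unit j h2]
    · simp only [hD1, hD2]
      rw [if_neg (hGk j hj), if_neg (hGk j hj), if_pos (hGT j hj), if_pos (hGT j hj)]
    -- The squeeze acts only on `i'`: it leaves the `i`-separation from `Cup` intact, is monotone
    -- between two obstacles, and keeps obstacles inside `T`.
    · intro j j' hjj
      have key := j1.target_mem.2.1 j j' hjj
      simp only [hD1] at key
      simp only [hD1, hD2]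
      by_cases h1 : j = k
      · have h1' : j' ≠ k := fun h => hjj (h1.trans h.symm)
        simp only [h1, h1', if_true, if_false] at key ⊢
        by_cases h2 : BoxSep (D j') T
        · simp only [h2, if_true] at key ⊢
          obtain ⟨l, hl | hl⟩ := key
          exacts [⟨l, Or.inl ⟨hl, hl⟩⟩, ⟨l, Or.inr ⟨hl, hl⟩⟩]
        · simp only [h2, if_false]
          refine ⟨i, ?_⟩
          simp only [hQ', sq_ne _ _ hii.symm]
          rcases hQC j' h1' h2 with h | h
          · have := h.trans (hCupC i).1
            exact Or.inr ⟨this, this⟩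
          · have := (hCupC i).2.trans h
            exact Or.inl ⟨this, this⟩
      · by_cases h1' : j' = k
        · simp only [h1, h1', if_true, if_false] at key ⊢
          by_cases h2 : BoxSep (D j) T
          · simp only [h2, if_true] at key ⊢
            obtain ⟨l, hl | hl⟩ := key
            exacts [⟨l, Or.inl ⟨hl, hl⟩⟩, ⟨l, Or.inr ⟨hl, hl⟩⟩]
          · simp only [h2, if_false]
            refine ⟨i, ?_⟩
            simp only [hQ', sq_ne _ _ hii.symm]
            rcases hQC j h1 h2 with h | h
            · have := h.trans (hCupC i).1
              exact Or.inl ⟨this, this⟩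
            · have := (hCupC i).2.trans h
              exact Or.inr ⟨this, this⟩
        · simp only [h1, h1', if_false] at key ⊢
          by_cases h2 : BoxSep (D j) T <;> by_cases h2' : BoxSep (D j') T <;>
            simp only [h2, h2', if_true, if_false] at key ⊢
          · obtain ⟨l, hl | hl⟩ := key
            exacts [⟨l, Or.inl ⟨hl, hl⟩⟩, ⟨l, Or.inr ⟨hl, hl⟩⟩]
          · obtain ⟨l, hl | hl⟩ := h2
            · exact ⟨l, Or.inl ⟨hl.trans (hQT j' l).1, hl.trans (hQ'T j' l).1⟩⟩
            · exact ⟨l, Or.inr ⟨(hQT j' l).2.trans hl, (hQ'T j' l).2.trans hl⟩⟩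
          · obtain ⟨l, hl | hl⟩ := h2'
            · exact ⟨l, Or.inr ⟨hl.trans (hQT j l).1, hl.trans (hQ'T j l).1⟩⟩
            · exact ⟨l, Or.inl ⟨(hQT j l).2.trans hl, (hQ'T j l).2.trans hl⟩⟩
          · obtain ⟨l, hl | hl⟩ := key
            exacts [⟨l, Or.inl ⟨hl, sq_mono l hl⟩⟩, ⟨l, Or.inr ⟨hl, sq_mono l hl⟩⟩]
  have j3 : JoinedIn (boxConf G D₀) D2 D3 := by
    -- The hyperplane at level `m` in direction `i'` separates box `k` from the obstacles throughout
    -- the stretch.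
    have hQ'Cup : ∀ j, (Q' j).2 i' ≤ Cup.1 i' := fun j => by simpa [hCup] using hQm j
    have hQ'Tup : ∀ j, (Q' j).2 i' ≤ Tup.1 i' := fun j => by simpa [hTup] using hQm j
    refine joinedIn_boxConf_of_common_sep j2.target_mem (fun j => ?_) (fun j hj => ?_) ?_
    · simp only [hD3]
      split_ifs with h1 h2
      exacts [unit_of (BoxLE.trans hTupT hTB) hpTup, hD.1 j, hQ'unit j h2]
    · simp only [hD3, hD2]
      rw [if_neg (hGk j hj), if_neg (hGk j hj)]
    · intro j j' hjj
      have key := j2.target_mem.2.1 j j' hjj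
      simp only [hD2] at key
      simp only [hD2, hD3]
      by_cases h1 : j = k
      · have h1' : j' ≠ k := fun h => hjj (h1.trans h.symm)
        simp only [h1, h1', if_true, if_false]
        by_cases h2 : BoxSep (D j') T
        · simp only [h2, if_true]
          obtain ⟨l, hl | hl⟩ := h2
          · exact ⟨l, Or.inr ⟨hl.trans (hCupT l).1, hl.trans (hTupT l).1⟩⟩
          · exact ⟨l, Or.inl ⟨(hCupT l).2.trans hl, (hTupT l).2.trans hl⟩⟩
        · simp only [h2, if_false]
          exact ⟨i', Or.inr ⟨hQ'Cup j', hQ'Tup j'⟩⟩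
      · by_cases h1' : j' = k
        · simp only [h1, h1', if_true, if_false]
          by_cases h2 : BoxSep (D j) T
          · simp only [h2, if_true]
            obtain ⟨l, hl | hl⟩ := h2
            · exact ⟨l, Or.inl ⟨hl.trans (hCupT l).1, hl.trans (hTupT l).1⟩⟩
            · exact ⟨l, Or.inr ⟨(hCupT l).2.trans hl, (hTupT l).2.trans hl⟩⟩
          · simp only [h2, if_false]
            exact ⟨i', Or.inl ⟨hQ'Cup j, hQ'Tup j⟩⟩
        · simp only [h1, h1', if_false] at key ⊢
          obtain ⟨l, hl | hl⟩ := key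
          exacts [⟨l, Or.inl ⟨hl, hl⟩⟩, ⟨l, Or.inr ⟨hl, hl⟩⟩]
  refine ⟨D3, (j1.trans j2).trans j3, ?_⟩
  simpa [hD3] using hpTup

end

/-! ### Travelling through the free region -/

/-- The points of the open unit cube off the closed boxes `D j`, `j ∈ G`. -/
def boxFree {n : ℕ} {K : Type*} (G : Set K) (D : K → (Fin n → ℝ) × (Fin n → ℝ)) :
    Set (Fin n → ℝ) :=
  {p | (∀ i, 0 < p i ∧ p i < 1) ∧ ∀ j ∈ G, ∃ i, p i < (D j).1 i ∨ (D j).2 i < p i}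

section

variable {n : ℕ} {K : Type*} {G : Set K} {D₀ D D' : K → (Fin n → ℝ) × (Fin n → ℝ)}

/-- Coordinates of `p` are replaced by those of `q` one at a time; the intermediate points stay in
`B` because `B` is a product. The bound on `n` supplies the second direction for each move. -/
theorem exists_joinedIn_of_boxMem (hn : 2 ≤ n) (hD : D ∈ boxConf G D₀) {k : K} (hk : k ∉ G)
    {B : (Fin n → ℝ) × (Fin n → ℝ)} (hB : IsUnitBox B) (hBG : ∀ j ∈ G, BoxSep (D₀ j) B)
    {p q : Fin n → ℝ} (hpD : BoxMem p (D k)) (hpB : BoxMem p B) (hqB : BoxMem q B) :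
    ∃ D', JoinedIn (boxConf G D₀) D D' ∧ BoxMem q (D' k) := by
  classical
  have key : ∀ s : Finset (Fin n),
      ∃ D', JoinedIn (boxConf G D₀) D D' ∧ BoxMem (s.piecewise q p) (D' k) := by
    intro s
    induction s using Finset.induction_on with
    | empty => exact ⟨D, JoinedIn.refl hD, by simpa using hpD⟩
    | insert i s _ ih =>
      obtain ⟨D', hj, hD'⟩ := ih
      have : Nontrivial (Fin n) := Fin.nontrivial_iff_two_le.2 hn
      obtain ⟨i', hii⟩ := exists_ne i
      obtain ⟨D'', hj', hD''⟩ := exists_joinedIn_update hii hj.target_mem hk hB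
        (fun j hjG => by rw [hj.target_mem.2.2 j hjG]; exact hBG j hjG) hD'
        (fun l => by
          by_cases hl : l ∈ s
          · rw [Finset.piecewise_eq_of_mem _ _ _ hl]; exact hqB l
          · rw [Finset.piecewise_eq_of_notMem _ _ _ hl]; exact hpB l) (hqB i)
      exact ⟨D'', hj.trans hj', by rw [Finset.piecewise_insert]; exact hD''⟩
  simpa using key Finset.univ

theorem isOpen_boxFree (hG : G.Finite) : IsOpen (boxFree G D) := by
  have : boxFree G D = (⋂ i, {p | 0 < p i} ∩ {p | p i < 1}) ∩
      ⋂ j ∈ G, ⋃ i, {p | p i < (D j).1 i} ∪ {p | (D j).2 i < p i} := by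
    ext p; simp [boxFree]
  rw [this]
  refine (isOpen_iInter_of_finite fun i => ?_).inter
    (hG.isOpen_biInter fun j _ => isOpen_iUnion fun i => ?_)
  · exact (isOpen_lt continuous_const (continuous_apply i)).inter
      (isOpen_lt (continuous_apply i) continuous_const)
  · exact (isOpen_lt (continuous_apply i) continuous_const).union
      (isOpen_lt continuous_const (continuous_apply i))

theorem mem_boxFree {A : (Fin n → ℝ) × (Fin n → ℝ)} (hA : IsUnitBox A)
    (hAG : ∀ j ∈ G, BoxSep (D j) A) {p : Fin n → ℝ} (hp : BoxMem p A) : p ∈ boxFree G D := by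
  refine ⟨fun i => ⟨(hA i).1.trans_lt (hp i).1, (hp i).2.trans_le (hA i).2.2⟩, fun j hj => ?_⟩
  obtain ⟨i, hi | hi⟩ := hAG j hj
  · exact ⟨i, Or.inr (hi.trans_lt (hp i).1)⟩
  · exact ⟨i, Or.inl ((hp i).2.trans_le hi)⟩

theorem isUnitBox_of_Icc_subset {u v : Fin n → ℝ} (huv : ∀ i, u i < v i)
    (h : Set.Icc u v ⊆ boxFree G D) : IsUnitBox (u, v) := fun i =>
  ⟨((h ⟨le_rfl, fun l => (huv l).le⟩).1 i).1.le, huv i,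
    ((h ⟨fun l => (huv l).le, le_rfl⟩).1 i).2.le⟩

theorem boxSep_of_Icc_subset {u v : Fin n → ℝ} (huv : ∀ i, u i < v i)
    (h : Set.Icc u v ⊆ boxFree G D) (hD : ∀ j, IsUnitBox (D j)) :
    ∀ j ∈ G, BoxSep (D j) (u, v) := by
  intro j hj
  by_contra hcon
  simp only [BoxSep, not_exists, not_or, not_le] at hcon
  -- Without separation, the coordinatewise maximum of the two lower corners lies in both closed
  -- boxes.
  obtain ⟨i, hi | hi⟩ := (@h (fun l => max (u l) ((D j).1 l))
    ⟨fun l => le_max_left _ _, fun l => max_le (huv l).le (hcon l).2.le⟩).2 j hj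
  · exact absurd hi (not_lt.2 (le_max_right _ _))
  · exact absurd hi (not_lt.2 (max_le (hcon i).1.le (hD j i).2.1.le))

theorem exists_closedBall_subset_of_isOpen {U : Set (Fin n → ℝ)} (hU : IsOpen U) {p : Fin n → ℝ}
    (hp : p ∈ U) : ∃ ε > 0, Metric.closedBall p ε ⊆ U :=
  Metric.nhds_basis_closedBall.mem_iff.1 (hU.mem_nhds hp)

theorem closedBall_eq_Icc (p : Fin n → ℝ) {ε : ℝ} (hε : 0 ≤ ε) :
    Metric.closedBall p ε = Set.Icc (fun i => p i - ε) (fun i => p i + ε) := by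
  ext y
  simp only [Metric.mem_closedBall, dist_pi_le_iff hε, Real.dist_eq, abs_le, Set.mem_Icc,
    Pi.le_def, ← forall_and]
  refine forall_congr' fun i => ?_
  constructor <;> rintro ⟨h1, h2⟩ <;> constructor <;> linarith

/-- A box can be moved so as to contain any given point of the connected free region. -/
theorem exists_joinedIn_of_isPreconnected (hn : 2 ≤ n) (hG : G.Finite) (hD : D ∈ boxConf G D₀)
    (hU : IsPreconnected (boxFree G D₀)) {k : K} (hk : k ∉ G) {p q : Fin n → ℝ}
    (hp : p ∈ boxFree G D₀) (hq : q ∈ boxFree G D₀) (hpD : BoxMem p (D k)) :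
    ∃ D', JoinedIn (boxConf G D₀) D D' ∧ BoxMem q (D' k) := by
  have hDG : ∀ j ∈ G, D j = D₀ j := hD.2.2
  have hfree : boxFree G D₀ = boxFree G D := by
    ext y
    refine and_congr_right fun _ => forall₂_congr fun j hj => ?_
    rw [hDG j hj]
  -- Reachability, quantified over all configurations, is transitive, and it holds both ways between
  -- a point and its neighbors, with a small cube as `B`. Connectedness makes it total.
  refine hU.induction₂' (fun p q => ∀ D ∈ boxConf G D₀, BoxMem p (D k) →
    ∃ D', JoinedIn (boxConf G D₀) D D' ∧ BoxMem q (D' k)) ?_ ?_ hp hq D hD hpD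
  · intro y hy
    obtain ⟨ε, hε, hball⟩ := exists_closedBall_subset_of_isOpen (isOpen_boxFree hG) hy
    rw [closedBall_eq_Icc _ hε.le] at hball
    have huv : ∀ i, y i - ε < y i + ε := fun i => by linarith
    have hB := isUnitBox_of_Icc_subset huv hball
    have hBG : ∀ j ∈ G, BoxSep (D₀ j) (fun i => y i - ε, fun i => y i + ε) := fun j hj => by
      rw [← hDG j hj]
      rw [hfree] at hball
      exact boxSep_of_Icc_subset huv hball hD.1 j hj
    have hyB : BoxMem y (fun i => y i - ε, fun i => y i + ε) := fun i =>
      ⟨by simp [hε], by simp [hε]⟩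
    filter_upwards [mem_nhdsWithin_of_mem_nhds (Metric.ball_mem_nhds y hε)] with z hz
    have hzB : BoxMem z (fun i => y i - ε, fun i => y i + ε) := fun i => by
      have h1 := (dist_le_pi_dist z y i).trans_lt hz
      rw [Real.dist_eq, abs_lt] at h1
      exact ⟨by linarith [h1.1], by linarith [h1.2]⟩
    exact ⟨fun E hE hyE => exists_joinedIn_of_boxMem hn hE hk hB hBG hyE hyB hzB,
      fun E hE hzE => exists_joinedIn_of_boxMem hn hE hk hB hBG hzE hzB hyB⟩
  · rintro a b c - - - h1 h2 E hE haE
    obtain ⟨E', hj, hE'⟩ := h1 E hE haE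
    obtain ⟨E'', hj', hE''⟩ := h2 E' hj.target_mem hE'
    exact ⟨E'', hj.trans hj', hE''⟩

end

/-! ### Placing one box and keeping the free region connected -/

/-- Removing a small closed ball from an open connected set in dimension at least two. -/
theorem IsPreconnected.diff_closedBall {E : Type*} [NormedAddCommGroup E] [NormedSpace ℝ E]
    (hE : 1 < Module.rank ℝ E) {U : Set E} (hU : IsPreconnected U) (hUo : IsOpen U) {p : E}
    {ρ r : ℝ} (hρ : 0 < ρ) (hρr : ρ < r) (hball : Metric.ball p r ⊆ U) :
    IsPreconnected (U \ Metric.closedBall p ρ) := by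
  -- In polar coordinates the collar is an interval times a sphere, which is connected in dimension
  -- above one.
  have hann : IsPreconnected (Metric.ball p r \ Metric.closedBall p ρ) := by
    have himg : Metric.ball p r \ Metric.closedBall p ρ =
        (fun y : ℝ × E => p + y.1 • y.2) '' (Set.Ioo ρ r ×ˢ Metric.sphere (0 : E) 1) := by
      ext z
      simp only [Set.mem_sdiff, Metric.mem_ball, Metric.mem_closedBall, not_le, Set.mem_image,
        Set.mem_prod, Set.mem_Ioo, mem_sphere_zero_iff_norm, Prod.exists]
      constructor
      · rintro ⟨h1, h2⟩
        rw [dist_eq_norm] at h1 h2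
        have h3 : ‖z - p‖ ≠ 0 := by linarith
        refine ⟨‖z - p‖, ‖z - p‖⁻¹ • (z - p), ⟨⟨h2, h1⟩, ?_⟩, ?_⟩
        · rw [norm_smul, norm_inv, norm_norm, inv_mul_cancel₀ h3]
        · rw [smul_smul, mul_inv_cancel₀ h3, one_smul, add_sub_cancel]
      · rintro ⟨a, b, ⟨⟨h1, h2⟩, h3⟩, rfl⟩
        have : dist (p + a • b) p = a := by
          rw [dist_eq_norm, add_sub_cancel_left, norm_smul, h3, mul_one, Real.norm_eq_abs,
            abs_of_pos (hρ.trans h1)]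
        rw [this]
        exact ⟨h2, h1⟩
    rw [himg]
    refine (isPreconnected_Ioo.prod (isPreconnected_sphere hE 0 1)).image _ ?_
    exact (continuous_const.add (continuous_fst.smul continuous_snd)).continuousOn
  have hUQ : IsOpen (U \ Metric.closedBall p ρ) := hUo.sdiff Metric.isClosed_closedBall
  -- If one open piece contains the collar, adding the ball to it turns the cover into a cover of
  -- `U` itself.
  have main : ∀ u v : Set E, IsOpen u → IsOpen v → U \ Metric.closedBall p ρ ⊆ u ∪ v →
      Metric.ball p r \ Metric.closedBall p ρ ⊆ u →
      ((U \ Metric.closedBall p ρ) ∩ v).Nonempty →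
      ((U \ Metric.closedBall p ρ) ∩ (u ∩ v)).Nonempty := by
    intro u v hu hv hcov hsub ⟨y, hy1, hy2⟩
    have hp : p ∈ Metric.ball p r := Metric.mem_ball_self (hρ.trans hρr)
    obtain ⟨z, hzU, hz1, hz2, hz3⟩ := hU (((U \ Metric.closedBall p ρ) ∩ u) ∪ Metric.ball p r)
      ((U \ Metric.closedBall p ρ) ∩ v) ((hUQ.inter hu).union Metric.isOpen_ball) (hUQ.inter hv)
      (fun z hz => by
        by_cases hzb : z ∈ Metric.ball p r
        · exact Or.inl (Or.inr hzb)
        · have hzQ : z ∈ U \ Metric.closedBall p ρ :=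
            ⟨hz, fun h => hzb (Metric.closedBall_subset_ball hρr h)⟩
          rcases hcov hzQ with h | h
          · exact Or.inl (Or.inl ⟨hzQ, h⟩)
          · exact Or.inr ⟨hzQ, h⟩)
      ⟨p, hball hp, Or.inr hp⟩ ⟨y, hy1.1, hy1, hy2⟩
    refine ⟨z, hz2, ?_, hz3⟩
    rcases hz1 with hz1 | hz1
    · exact hz1.2
    · exact hsub ⟨hz1, hz2.2⟩
  intro u v hu hv hcov hneu hnev
  by_cases hsu : ((Metric.ball p r \ Metric.closedBall p ρ) ∩ u).Nonempty
  · by_cases hsv : ((Metric.ball p r \ Metric.closedBall p ρ) ∩ v).Nonempty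
    · exact (hann u v hu hv ((Set.sdiff_subset_sdiff_left hball).trans hcov) hsu hsv).mono
        (Set.inter_subset_inter_left _ (Set.sdiff_subset_sdiff_left hball))
    · refine main u v hu hv hcov (fun z hz => ?_) hnev
      exact (hcov ⟨hball hz.1, hz.2⟩).resolve_right fun h => hsv ⟨z, hz, h⟩
  · rw [Set.inter_comm u v]
    refine main v u hv hu (by rwa [Set.union_comm]) (fun z hz => ?_) hneu
    exact (hcov ⟨hball hz.1, hz.2⟩).resolve_left fun h => hsu ⟨z, hz, h⟩

section

variable {n : ℕ} {K : Type*} {G : Set K} {D : K → (Fin n → ℝ) × (Fin n → ℝ)}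

theorem boxMem_midpoint {A : (Fin n → ℝ) × (Fin n → ℝ)} (hA : IsUnitBox A) :
    BoxMem (fun i => (A.1 i + A.2 i) / 2) A := fun i => by
  have := (hA i).2.1
  constructor <;> dsimp only <;> linarith

theorem isOpen_boxMem (A : (Fin n → ℝ) × (Fin n → ℝ)) : IsOpen {p | BoxMem p A} := by
  have : {p | BoxMem p A} = ⋂ i, {p | A.1 i < p i} ∩ {p | p i < A.2 i} := by
    ext p; simp [BoxMem]
  rw [this]
  exact isOpen_iInter_of_finite fun i => (isOpen_lt continuous_const (continuous_apply i)).inter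
      (isOpen_lt (continuous_apply i) continuous_const)

/-- One further box can be moved into its target, keeping the free region connected. -/
theorem exists_joinedIn_boxLE (hn : 2 ≤ n) (hG : G.Finite) (hD : D ∈ boxConf G D)
    (hU : IsPreconnected (boxFree G D)) {k : K} (hk : k ∉ G)
    {A : (Fin n → ℝ) × (Fin n → ℝ)} (hA : IsUnitBox A) (hAG : ∀ j ∈ G, BoxSep (D j) A) :
    ∃ D', JoinedIn (boxConf G D) D D' ∧ BoxLE (D' k) A ∧
      IsPreconnected (boxFree (insert k G) D') := by
  classical
  have hq := mem_boxFree hA hAG (boxMem_midpoint hA)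
  set q : Fin n → ℝ := fun i => (A.1 i + A.2 i) / 2 with hqdef
  have hp := mem_boxFree (hD.1 k) (fun j hj => hD.2.1 j k (fun h => hk (h ▸ hj)))
    (boxMem_midpoint (hD.1 k))
  obtain ⟨D', hj, hqD'⟩ := exists_joinedIn_of_isPreconnected hn hG hD hU hk hp hq
    (boxMem_midpoint (hD.1 k))
  obtain ⟨ε, hε, hball⟩ := exists_closedBall_subset_of_isOpen
    (((isOpen_boxFree (D := D) hG).inter (isOpen_boxMem A)).inter (isOpen_boxMem (D' k)))
    (p := q) ⟨⟨hq, boxMem_midpoint hA⟩, hqD'⟩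
  have hρ : 0 < ε / 2 := by positivity
  -- A cube is a closed ball of the sup metric. Half the radius leaves a collar inside the free
  -- region, as `IsPreconnected.diff_closedBall` requires.
  set Q : (Fin n → ℝ) × (Fin n → ℝ) := (fun i => q i - ε / 2, fun i => q i + ε / 2) with hQ
  have hIcc : Set.Icc Q.1 Q.2 ⊆
      boxFree G D ∩ {p | BoxMem p A} ∩ {p | BoxMem p (D' k)} := by
    rw [hQ, ← closedBall_eq_Icc _ hρ.le]
    exact (Metric.closedBall_subset_closedBall (by linarith)).trans hball
  have hQlt : ∀ i, Q.1 i < Q.2 i := fun i => by simp only [hQ]; linarith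
  have hl : Q.1 ∈ Set.Icc Q.1 Q.2 := ⟨le_rfl, fun i => (hQlt i).le⟩
  have hr : Q.2 ∈ Set.Icc Q.1 Q.2 := ⟨fun i => (hQlt i).le, le_rfl⟩
  have hQunit : IsUnitBox Q := isUnitBox_of_Icc_subset hQlt fun y hy => (hIcc hy).1.1
  have hQA : BoxLE Q A := fun i => ⟨((hIcc hl).1.2 i).1.le, ((hIcc hr).1.2 i).2.le⟩
  have hQD' : BoxLE Q (D' k) := fun i => ⟨((hIcc hl).2 i).1.le, ((hIcc hr).2 i).2.le⟩
  have hne : ∀ j ∈ G, j ≠ k := fun j hj h => hk (h ▸ hj)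
  have hj' : JoinedIn (boxConf G D) D' (Function.update D' k Q) := by
    refine joinedIn_boxConf_of_boxLE hj.target_mem (fun j => ?_) (fun j hj => ?_) fun j => ?_
    · by_cases h : j = k
      · subst h; simpa using hQunit
      · simpa [h] using hj.target_mem.1 j
    · simp [hne j hj]
    · by_cases h : j = k
      · subst h; simpa using hQD'
      · simpa [h] using BoxLE.refl (D' j)
  refine ⟨_, hj.trans hj', by simpa using hQA, ?_⟩
  have hfree : boxFree (insert k G) (Function.update D' k Q) =
      boxFree G D \ Metric.closedBall q (ε / 2) := by
    rw [closedBall_eq_Icc _ hρ.le]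
    ext y
    have h1 : (∀ j ∈ G, ∃ i, y i < (Function.update D' k Q j).1 i ∨
        (Function.update D' k Q j).2 i < y i) ↔
        ∀ j ∈ G, ∃ i, y i < (D j).1 i ∨ (D j).2 i < y i := by
      refine forall₂_congr fun j hjG => ?_
      rw [Function.update_of_ne (hne j hjG), hj.target_mem.2.2 j hjG]
    have h2 : y ∉ Set.Icc (fun i => q i - ε / 2) (fun i => q i + ε / 2) ↔
        ∃ i, y i < Q.1 i ∨ Q.2 i < y i := by
      simp only [Set.mem_Icc, Pi.le_def, ← forall_and, not_forall, hQ]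
      refine exists_congr fun i => ?_
      rw [not_and_or, not_le, not_le]
    simp only [boxFree, Set.mem_sdiff, Set.mem_ofPred_eq, Set.forall_mem_insert, h1, h2,
      Function.update_self]
    rw [and_assoc]
    exact and_congr_right fun _ => and_comm
  rw [hfree]
  refine hU.diff_closedBall ?_ (isOpen_boxFree hG) hρ (show ε / 2 < ε by linarith)
    fun y hy => (hball (Metric.ball_subset_closedBall hy)).1.1
  rw [← Module.finrank_eq_rank, Module.finrank_fin_fun]
  exact_mod_cast hn

end

/-! ### Infinitely many moves -/

/-- Infinite concatenation of paths in a subset of a product, in which every coordinate is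
eventually constant. -/
theorem joinedIn_of_eventually_const {ι : Type*} {Y : ι → Type*} [∀ i, TopologicalSpace (Y i)]
    {C : Set (∀ i, Y i)} {D : ℕ → ∀ i, Y i} {L : ∀ i, Y i} (hL : L ∈ C) (A : ℕ → Set ι)
    (hA : ∀ i, ∀ᶠ m in Filter.atTop, i ∈ A m)
    (hD : ∀ m, JoinedIn (C ∩ {y | ∀ i ∈ A m, y i = L i}) (D m) (D (m + 1))) :
    JoinedIn C (D 0) L := by
  choose γ hγ using hD
  set g : ℝ → ∀ i, Y i := fun s => (γ ⌊s⌋₊).extend (s - ⌊s⌋₊) with hg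
  have hgfloor : ∀ (m : ℕ) (s : ℝ), ⌊s⌋₊ = m → g s = (γ m).extend (s - m) := by
    rintro _ s rfl; rfl
  have hgmem : ∀ s, g s ∈ C ∩ {y | ∀ i ∈ A ⌊s⌋₊, y i = L i} := fun s => hγ _ _
  have hgeq : ∀ m : ℕ, ∀ s ∈ Set.Icc (m : ℝ) ((m + 1 : ℕ) : ℝ),
      g s = (γ m).extend (s - m) := by
    intro m s hs
    rcases hs.2.eq_or_lt with h | h
    · simp only [hg]
      rw [h, Nat.floor_natCast, sub_self, Path.extend_zero, Nat.cast_succ, add_sub_cancel_left,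
        Path.extend_one]
    · have : ⌊s⌋₊ = m := (Nat.floor_eq_iff ((Nat.cast_nonneg m).trans hs.1)).2
        ⟨hs.1, by exact_mod_cast h⟩
      exact hgfloor m s this
  have hg0 : ∀ s ≤ (0 : ℝ), g s = D 0 := by
    intro s hs
    have : ⌊s⌋₊ = 0 := Nat.floor_of_nonpos hs
    rw [hgfloor 0 s this, Nat.cast_zero, sub_zero]
    exact Path.extend_of_le_zero _ hs
  have hgon : ∀ N : ℕ, ContinuousOn g (Set.Iic (N : ℝ)) := by
    intro N
    induction N with
    | zero =>
      refine (continuousOn_const (c := D 0)).congr fun s hs => hg0 s ?_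
      simpa using hs
    | succ N ih =>
      have : Set.Iic ((N + 1 : ℕ) : ℝ) = Set.Iic (N : ℝ) ∪ Set.Icc (N : ℝ) ((N + 1 : ℕ) : ℝ) :=
        (Set.Iic_union_Icc_eq_Iic (by exact_mod_cast N.le_succ)).symm
      rw [this]
      refine ih.union_of_isClosed ?_ isClosed_Iic isClosed_Icc
      exact ((γ N).continuous_extend.comp (continuous_id.sub continuous_const)).continuousOn.congr
        (hgeq N)
  have hgc : Continuous g := continuous_iff_continuousAt.2 fun s => by
    obtain ⟨N, hN⟩ := exists_nat_gt s
    exact (hgon N).continuousAt (Iic_mem_nhds hN)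
  -- The half-line is compressed to `[0, 1)`. Continuity at `1` is checked coordinatewise: for `t >
  -- 1 - 1 / (N + 1)` the time `t / (1 - t)` exceeds `N`, when coordinate `i` is already `L i`.
  set h : ℝ → ∀ i, Y i := fun t => if t < 1 then g (t / (1 - t)) else L with hh
  have hc : Continuous h := by
    rw [continuous_iff_continuousAt]
    intro t
    rcases lt_trichotomy t 1 with ht | rfl | ht
    · have : ContinuousAt (fun t : ℝ => g (t / (1 - t))) t :=
        hgc.continuousAt.comp (continuousAt_id.div (continuousAt_const.sub continuousAt_id)
          (sub_ne_zero.2 ht.ne'))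
      refine this.congr ?_
      filter_upwards [Iio_mem_nhds ht] with u hu
      exact (if_pos hu).symm
    · rw [continuousAt_pi]
      intro i
      obtain ⟨N, hN⟩ := Filter.eventually_atTop.1 (hA i)
      refine (continuousAt_const (y := L i)).congr ?_
      have h0 : (1 : ℝ) - 1 / (N + 1 : ℝ) < 1 := by
        have : (0 : ℝ) < 1 / (N + 1 : ℝ) := by positivity
        linarith
      filter_upwards [Ioi_mem_nhds h0] with u hu
      by_cases hu1 : u < 1
      · simp only [hh, if_pos hu1]
        refine ((hgmem _).2 i (hN _ (Nat.le_floor ?_))).symm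
        rw [le_div_iff₀ (by linarith)]
        have hu' : 1 - 1 / (N + 1 : ℝ) < u := hu
        have h1 : (N + 1 : ℝ) * (1 / (N + 1 : ℝ)) = 1 := by field_simp
        have h2 := mul_lt_mul_of_pos_left hu' (show (0 : ℝ) < N + 1 by positivity)
        linarith
      · simp only [hh, if_neg hu1]
    · refine (continuousAt_const (y := L)).congr ?_
      filter_upwards [Ioi_mem_nhds ht] with u hu
      exact (if_neg (not_lt.2 (le_of_lt hu))).symm
  refine JoinedIn.ofLine hc.continuousOn ?_ ?_ ?_
  · simp only [hh, zero_lt_one, if_true, zero_div]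
    exact hg0 0 le_rfl
  · simp [hh]
  · rintro _ ⟨t, -, rfl⟩
    by_cases ht : t < 1
    · simp only [hh, if_pos ht]; exact (hgmem _).1
    · simp only [hh, if_neg ht]; exact hL

section

variable {n : ℕ}

/-- Two configurations which agree on `F`, and whose free region is connected, are joined. -/
theorem joinedIn_boxConf (hn : 2 ≤ n) {K : Set ℕ} {F : Set K} (hF : F.Finite)
    {R S : K → (Fin n → ℝ) × (Fin n → ℝ)} (hR : R ∈ boxConf F R) (hS : S ∈ boxConf F R)
    (hU : IsPreconnected (boxFree F R)) : JoinedIn (boxConf F R) R S := by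
  set G : ℕ → Set K := fun m => F ∪ {j | (j : ℕ) < m} with hG
  have hGfin : ∀ m, (G m).Finite := fun m =>
    hF.union ((Set.finite_lt_nat m).preimage Subtype.val_injective.injOn)
  have hGmono : Monotone G := fun a b hab =>
    Set.union_subset_union_right _ fun j (hj : (j : ℕ) < a) => hj.trans_le hab
  have hGself : ∀ j : K, j ∈ G (j + 1) := fun j => Or.inr (Nat.lt_succ_self _)
  -- Placed boxes lie inside their targets so that the next target `S k` is separated from them.
  let Good : ℕ → (K → (Fin n → ℝ) × (Fin n → ℝ)) → Prop := fun m D =>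
    D ∈ boxConf (G m) D ∧ IsPreconnected (boxFree (G m) D) ∧ ∀ j ∈ G m, BoxLE (D j) (S j)
  have step : ∀ m D, Good m D → ∃ D', JoinedIn (boxConf (G m) D) D D' ∧ Good (m + 1) D' := by
    rintro m D ⟨h1, h2, h3⟩
    by_cases hm : ∃ k : K, (k : ℕ) = m ∧ k ∉ F
    · obtain ⟨k, hkm, hkF⟩ := hm
      have hk : k ∉ G m := by
        rintro (h | h)
        · exact hkF h
        · exact absurd h (not_lt.2 hkm.ge)
      have hins : insert k (G m) = G (m + 1) := by
        ext j
        simp only [hG, Set.mem_insert_iff, Set.mem_union, Set.mem_ofPred_eq, Nat.lt_succ_iff_lt_or_eq,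
          ← hkm, Subtype.ext_iff]
        tauto
      obtain ⟨D', hj, hle, hpre⟩ := exists_joinedIn_boxLE hn (hGfin m) h1 h2 hk (hS.1 k)
        (fun j hj => (hS.2.1 j k fun h => hk (h ▸ hj)).mono (h3 j hj) (BoxLE.refl _))
      rw [hins] at hpre
      refine ⟨D', hj, ⟨hj.target_mem.1, hj.target_mem.2.1, fun _ _ => rfl⟩, hpre, ?_⟩
      rw [← hins]
      rintro j (rfl | hj')
      · exact hle
      · rw [hj.target_mem.2.2 j hj']; exact h3 j hj'
    -- Here `m` is not an index or its box is already prescribed, so nothing moves.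
    · have hins : G (m + 1) = G m := by
        refine (Set.union_subset Set.subset_union_left fun j hj => ?_).antisymm
          (hGmono m.le_succ)
        rcases Nat.lt_succ_iff_lt_or_eq.1 hj with h | h
        · exact Or.inr h
        · exact Or.inl (by_contra fun h' => hm ⟨j, h, h'⟩)
      refine ⟨D, JoinedIn.refl h1, ?_⟩
      simp only [Good, hins]
      exact ⟨h1, h2, h3⟩
  have hG0 : G 0 = F := by simp [hG]
  have good0 : Good 0 R := by
    simp only [Good, hG0]
    exact ⟨hR, hU, fun j hj => by rw [hS.2.2 j hj]; exact BoxLE.refl _⟩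
  choose! next hnext using step
  let D : ℕ → K → (Fin n → ℝ) × (Fin n → ℝ) := fun m => Nat.rec R (fun m E => next m E) m
  have hgood : ∀ m, Good m (D m) := by
    intro m
    induction m with
    | zero => exact good0
    | succ m ih => exact (hnext m _ ih).2
  have hjoin : ∀ m, JoinedIn (boxConf (G m) (D m)) (D m) (D (m + 1)) := fun m =>
    (hnext m _ (hgood m)).1
  have hstab : ∀ m m', m ≤ m' → ∀ j ∈ G m, D m' j = D m j := by
    intro m m' hmm
    induction m', hmm using Nat.le_induction with
    | base => exact fun _ _ => rfl
    | succ m' hmm ih =>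
      intro j hj
      rw [(hjoin m').target_mem.2.2 j (hGmono hmm hj), ih j hj]
  -- Box `j` is frozen from stage `j + 1` on, so this is the limit configuration.
  set L : K → (Fin n → ℝ) × (Fin n → ℝ) := fun j => D (j + 1) j with hLdef
  have hL : ∀ m, ∀ j ∈ G m, D m j = L j := fun m j hj => by
    change D m j = D (j + 1) j
    rw [← hstab m _ (le_max_left m (j + 1)) j hj,
      ← hstab _ _ (le_max_right m (j + 1)) j (hGself j)]
  have hLR : ∀ j ∈ F, L j = R j := fun j hj => (hL 0 j (Or.inl hj)).symm
  have hLconf : L ∈ boxConf F R := by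
    refine ⟨fun k => (hgood (k + 1)).1.1 k, fun j k hjk => ?_, hLR⟩
    rw [← hL (max (j + 1) (k + 1)) j (hGmono (le_max_left _ _) (hGself j)),
      ← hL (max (j + 1) (k + 1)) k (hGmono (le_max_right _ _) (hGself k))]
    exact (hgood _).1.2.1 j k hjk
  have hRL : JoinedIn (boxConf F R) (D 0) L := by
    refine joinedIn_of_eventually_const hLconf G (fun j => ?_) fun m => (hjoin m).mono ?_
    · exact Filter.eventually_atTop.2 ⟨j + 1, fun m hm => hGmono hm (hGself j)⟩
    · refine fun E hE => ⟨⟨hE.1, hE.2.1, fun j hj => ?_⟩, fun j hj => ?_⟩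
      · rw [hE.2.2 j (Or.inl hj), hL m j (Or.inl hj), hLR j hj]
      · rw [hE.2.2 j hj, hL m j hj]
  refine hRL.trans (joinedIn_boxConf_of_boxLE hS hLconf.1 (fun j hj => ?_) fun j => ?_).symm
  · rw [hLR j hj, hS.2.2 j hj]
  · exact (hgood _).2.2 j (hGself j)

end

/-! ### From paths in the closed cube to the open free region -/

/-- If points of the free region can be joined in the closed unit cube off the closed boxes, then
the free region of the open unit cube is connected. -/
theorem isPreconnected_boxFree {n : ℕ} {K : Type*} {G : Set K} (hG : G.Finite)
    {D : K → (Fin n → ℝ) × (Fin n → ℝ)}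
    (h : ∀ a ∈ boxFree G D, ∀ b ∈ boxFree G D, JoinedIn {p : Fin n → ℝ |
      (∀ i, 0 ≤ p i ∧ p i ≤ 1) ∧ ∀ j ∈ G, ∃ i, p i < (D j).1 i ∨ (D j).2 i < p i} a b) :
    IsPreconnected (boxFree G D) := by
  set O : Set (Fin n → ℝ) := {p | ∀ j ∈ G, ∃ i, p i < (D j).1 i ∨ (D j).2 i < p i} with hO
  have hOo : IsOpen O := by
    have : O = ⋂ j ∈ G, ⋃ i, {p | p i < (D j).1 i} ∪ {p | (D j).2 i < p i} := by
      ext p; simp [hO]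
    rw [this]
    exact hG.isOpen_biInter fun j _ => isOpen_iUnion fun i =>
      (isOpen_lt (continuous_apply i) continuous_const).union
        (isOpen_lt continuous_const (continuous_apply i))
  have joined : ∀ a ∈ boxFree G D, ∀ b ∈ boxFree G D, JoinedIn (boxFree G D) a b := by
    intro a ha b hb
    obtain ⟨γ, hγ⟩ := h a ha b hb
    -- Contraction towards the center of the cube. By compactness of the path, some `s₀ > 0` moves
    -- all of it off the boundary while avoiding the boxes.
    set push : ℝ → (Fin n → ℝ) → Fin n → ℝ := fun s y i => (1 - s) * y i + s / 2 with hpush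
    have hpc : Continuous fun q : ℝ × (Fin n → ℝ) => push q.1 q.2 := by
      simp only [hpush]; fun_prop
    have hp0 : ∀ y, push 0 y = y := fun y => by simp [hpush]
    have hev : ∀ᶠ s in 𝓝 (0 : ℝ), ∀ t ∈ (Set.univ : Set I), push s (γ t) ∈ O := by
      refine isCompact_univ.eventually_forall_of_forall_eventually
        (P := fun s t => push s (γ t) ∈ O) fun t _ => ?_
      have hc : Continuous fun z : ℝ × I => push z.1 (γ z.2) :=
        hpc.comp (continuous_fst.prodMk (γ.continuous.comp continuous_snd))
      refine hc.continuousAt.eventually_mem (hOo.mem_nhds ?_)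
      simp only [hp0]
      exact (hγ t).2
    obtain ⟨δ, hδ, hball⟩ := Metric.eventually_nhds_iff.1 hev
    set s₀ : ℝ := min (δ / 2) 1 with hs₀
    have hs0 : 0 < s₀ := lt_min (by positivity) one_pos
    have hs1 : s₀ ≤ 1 := min_le_right _ _
    have hmem : ∀ s ∈ Set.Icc 0 s₀, ∀ t, push s (γ t) ∈ O := fun s hs t => by
      refine hball ?_ t (Set.mem_univ t)
      rw [Real.dist_eq, sub_zero, abs_of_nonneg hs.1]
      linarith [hs.2, min_le_left (δ / 2) 1]
    have hint : ∀ s, 0 < s → s ≤ 1 → ∀ y : Fin n → ℝ, (∀ i, 0 ≤ y i ∧ y i ≤ 1) →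
        ∀ i, 0 < push s y i ∧ push s y i < 1 := fun s h0 h1 y hy i => by
      have h2 := mul_nonneg (sub_nonneg.2 h1) (hy i).1
      have h3 := mul_nonneg (sub_nonneg.2 h1) (sub_nonneg.2 (hy i).2)
      simp only [hpush]
      constructor <;> linarith
    have hend : ∀ t, γ t ∈ boxFree G D → JoinedIn (boxFree G D) (γ t) (push s₀ (γ t)) := by
      intro t ht
      refine JoinedIn.ofLine (f := fun s => push (s * s₀) (γ t)) ?_ (by simp [hp0]) (by simp) ?_
      · exact (hpc.comp ((continuous_id.mul continuous_const).prodMk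
          continuous_const)).continuousOn
      · rintro _ ⟨s, hs, rfl⟩
        have h1 : s * s₀ ≤ s₀ := mul_le_of_le_one_left hs0.le hs.2
        have h2 : 0 ≤ s * s₀ := mul_nonneg hs.1 hs0.le
        refine ⟨?_, hmem _ ⟨h2, h1⟩ t⟩
        rcases h2.eq_or_lt with h2 | h2
        · simp only [← h2, hp0]; exact ht.1
        · exact hint _ h2 (h1.trans hs1) _ (hγ t).1
    have hmid : JoinedIn (boxFree G D) (push s₀ a) (push s₀ b) :=
      ⟨γ.map (hpc.comp (continuous_const.prodMk continuous_id)),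
        fun t => ⟨hint _ hs0 hs1 _ (hγ t).1, hmem _ ⟨hs0.le, le_rfl⟩ t⟩⟩
    have h1 := hend 0 (by simpa using ha)
    have h2 := hend 1 (by simpa using hb)
    rw [γ.source] at h1
    rw [γ.target] at h2
    exact (h1.trans hmid).trans h2.symm
  refine isPreconnected_of_forall_pair fun a ha b hb => ?_
  obtain ⟨γ, hγ⟩ := joined a ha b hb
  exact ⟨Set.range γ, Set.range_subset_iff.2 hγ, ⟨0, γ.source⟩, ⟨1, γ.target⟩,
    isPreconnected_range γ.continuous⟩

/-! ### Translation between cubes and boxes -/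

namespace NCube

variable {n : ℕ}

/-- The corners of an `n`-cube, as a box. -/
def toBox (R : NCube n) : (Fin n → ℝ) × (Fin n → ℝ) := (fun i => R.lo i, fun i => R.hi i)

/-- The `n`-cube with given corners. -/
def ofBox (A : (Fin n → ℝ) × (Fin n → ℝ)) (hA : IsUnitBox A) : NCube n where
  lo i := ⟨A.1 i, (hA i).1, (hA i).2.1.le.trans (hA i).2.2⟩
  hi i := ⟨A.2 i, (hA i).1.trans (hA i).2.1.le, (hA i).2.2⟩
  lo_lt_hi i := (hA i).2.1

theorem isUnitBox_toBox (R : NCube n) : IsUnitBox R.toBox := fun i =>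
  ⟨(R.lo i).2.1, R.lo_lt_hi i, (R.hi i).2.2⟩

theorem ofBox_eq (R : NCube n) {A : (Fin n → ℝ) × (Fin n → ℝ)} {hA : IsUnitBox A}
    (h : A = R.toBox) : ofBox A hA = R := by
  subst h; rfl

theorem toSet_injective : Function.Injective (toSet : NCube n → Set (Fin n → I)) := by
  intro R S h
  have hlo : ∀ R : NCube n, R.lo ∈ R.toSet := fun R i => ⟨le_rfl, (R.lo_lt_hi i).le⟩
  have hhi : ∀ R : NCube n, R.hi ∈ R.toSet := fun R i => ⟨(R.lo_lt_hi i).le, le_rfl⟩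
  have h1 : R.lo ∈ S.toSet := h ▸ hlo R
  have h2 : R.hi ∈ S.toSet := h ▸ hhi R
  have h3 : S.lo ∈ R.toSet := h ▸ hlo S
  have h4 : S.hi ∈ R.toSet := h ▸ hhi S
  ext i
  · rw [le_antisymm (h3 i).1 (h1 i).1]
  · rw [le_antisymm (h2 i).2 (h4 i).2]

theorem boxSep_toBox {R S : NCube n} (h : Disjoint (interior R.toSet) (interior S.toSet)) :
    BoxSep R.toBox S.toBox := by
  by_contra hcon
  simp only [BoxSep, not_exists, not_or, not_le, toBox, Subtype.coe_lt_coe] at hcon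
  have key : ∀ i, ∃ c : I, max (R.lo i) (S.lo i) < c ∧ c < min (R.hi i) (S.hi i) := fun i =>
    exists_between (max_lt (lt_min (R.lo_lt_hi i) (hcon i).2)
      (lt_min (hcon i).1 (S.lo_lt_hi i)))
  choose c hc1 hc2 using key
  refine Set.disjoint_left.1 h (R.openBox_subset_interior (a := c) fun i => ?_)
    (S.openBox_subset_interior (a := c) fun i => ?_)
  · exact ⟨(max_lt_iff.1 (hc1 i)).1, (lt_min_iff.1 (hc2 i)).1⟩
  · exact ⟨(max_lt_iff.1 (hc1 i)).2, (lt_min_iff.1 (hc2 i)).2⟩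

/-- Evaluation at `i` is an open map, so a common interior would have a nonempty open image, hence
an infinite one; but that image is at most a point. -/
theorem disjoint_interior_of_hi_le {R S : NCube n} {i : Fin n} (h : R.hi i ≤ S.lo i) :
    Disjoint (interior R.toSet) (interior S.toSet) := by
  rw [Set.disjoint_left]
  intro b hR hS
  have hopen := isOpenMap_eval i _
    ((isOpen_interior (s := R.toSet)).inter (isOpen_interior (s := S.toSet)))
  refine infinite_of_mem_nhds (b i) (hopen.mem_nhds ⟨b, ⟨hR, hS⟩, rfl⟩)
    (Set.Subsingleton.finite ?_)
  have hval : ∀ c ∈ interior R.toSet ∩ interior S.toSet, c i = R.hi i := fun c hc =>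
    le_antisymm (interior_subset hc.1 i).2 (h.trans (interior_subset hc.2 i).1)
  rintro _ ⟨c, hc, rfl⟩ _ ⟨d, hd, rfl⟩
  exact (hval c hc).trans (hval d hd).symm

theorem disjoint_interior_ofBox {A B : (Fin n → ℝ) × (Fin n → ℝ)} (hA : IsUnitBox A)
    (hB : IsUnitBox B) (h : BoxSep A B) :
    Disjoint (interior (ofBox A hA).toSet) (interior (ofBox B hB).toSet) := by
  obtain ⟨i, hi | hi⟩ := h
  · exact disjoint_interior_of_hi_le (i := i) hi
  · exact (disjoint_interior_of_hi_le (R := ofBox B hB) (S := ofBox A hA) (i := i) hi).symm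

theorem continuous_rescale_ofBox {T : Type*} [TopologicalSpace T]
    {A : T → (Fin n → ℝ) × (Fin n → ℝ)} (hA : Continuous A) (hbox : ∀ t, IsUnitBox (A t)) :
    Continuous fun p : T × (Fin n → I) => (ofBox (A p.1) (hbox p.1)).rescale p.2 := by
  have h1 : ∀ i, Continuous fun p : T × (Fin n → I) => (A p.1).1 i := fun i =>
    (continuous_apply i).comp (continuous_fst.comp (hA.comp continuous_fst))
  have h2 : ∀ i, Continuous fun p : T × (Fin n → I) => (A p.1).2 i := fun i =>
    (continuous_apply i).comp (continuous_snd.comp (hA.comp continuous_fst))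
  have h3 : ∀ i, Continuous fun p : T × (Fin n → I) => ((p.2 i : I) : ℝ) := fun i =>
    continuous_subtype_val.comp ((continuous_apply i).comp continuous_snd)
  refine continuous_pi fun i => continuous_projIcc.comp ?_
  exact ((h3 i).sub (h1 i)).div ((h2 i).sub (h1 i)) fun p =>
    (sub_pos.2 (hbox p.1 i).2.1).ne'

end NCube

/-! ### From paths of configurations to homotopies -/

namespace NDomain

variable {n : ℕ} {K : Type*}

/-- The boxes of an `n`-domain. -/
def toBoxes (R : NDomain n K) : K → (Fin n → ℝ) × (Fin n → ℝ) := fun k => (R.cube k).toBox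

theorem toBoxes_mem (R : NDomain n K) {F : Set K} {D₀ : K → (Fin n → ℝ) × (Fin n → ℝ)}
    (h : ∀ k ∈ F, R.toBoxes k = D₀ k) : R.toBoxes ∈ boxConf F D₀ :=
  ⟨fun k => (R.cube k).isUnitBox_toBox,
    fun j k hjk => NCube.boxSep_toBox (R.disjoint_interior j k hjk), h⟩

/-- The `n`-domain with given boxes. -/
def ofBoxes {F : Set K} {D₀ : K → (Fin n → ℝ) × (Fin n → ℝ)} (D : K → (Fin n → ℝ) × (Fin n → ℝ))
    (hD : D ∈ boxConf F D₀) : NDomain n K where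
  cube k := NCube.ofBox (D k) (hD.1 k)
  disjoint_interior j k hjk := NCube.disjoint_interior_ofBox _ _ (hD.2.1 j k hjk)

theorem ofBoxes_eq (R : NDomain n K) {F : Set K} {D₀ D : K → (Fin n → ℝ) × (Fin n → ℝ)}
    {hD : D ∈ boxConf F D₀} (h : D = R.toBoxes) : ofBoxes D hD = R := by
  subst h; rfl

variable {X : Type*} [TopologicalSpace X] {x : X}

/-- Each box need only vary continuously by itself: if `x ∈ U`, the preimage of `U` is cut out by
the finitely many loops leaving `U`; otherwise it is a union of open sets. -/
theorem continuous_concatFun_family {T : Type*} [TopologicalSpace T] (R : T → NDomain n K)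
    (hR : ∀ k, Continuous fun p : T × (Fin n → I) => ((R p.1).cube k).rescale p.2)
    {f : K → GenLoop (Fin n) X x} (hf : IsKSequence f) :
    Continuous fun p : T × (Fin n → I) => (R p.1).concatFun f p.2 := by
  have hc : ∀ k, Continuous fun p : T × (Fin n → I) => f k (((R p.1).cube k).rescale p.2) :=
    fun k => (f k).1.continuous.comp (hR k)
  rw [continuous_def]
  intro U hU
  by_cases hx : x ∈ U
  · have : (fun p : T × (Fin n → I) => (R p.1).concatFun f p.2) ⁻¹' U =
        ⋂ k ∈ {k | ¬ Set.range (f k) ⊆ U},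
          (fun p : T × (Fin n → I) => f k (((R p.1).cube k).rescale p.2)) ⁻¹' U := by
      ext ⟨t, b⟩
      simp only [Set.mem_iInter, Set.mem_preimage]
      constructor
      · intro hb k _
        rcases (R t).rescale_eq_or f b k with h | h <;> rw [h] <;> assumption
      · intro hb
        rcases (R t).concatFun_eq_or f b with h | ⟨k, h⟩
        · rwa [h]
        · rw [h]
          by_cases hk : Set.range (f k) ⊆ U
          · exact hk ⟨_, rfl⟩
          · exact hb k hk
    rw [this]
    exact (hf.isNullAt U (hU.mem_nhds hx)).isOpen_biInter fun k _ => hU.preimage (hc k)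
  · have : (fun p : T × (Fin n → I) => (R p.1).concatFun f p.2) ⁻¹' U =
        ⋃ k, (fun p : T × (Fin n → I) => f k (((R p.1).cube k).rescale p.2)) ⁻¹' U := by
      ext ⟨t, b⟩
      simp only [Set.mem_iUnion, Set.mem_preimage]
      constructor
      · intro hb
        rcases (R t).concatFun_eq_or f b with h | ⟨k, h⟩
        · rw [h] at hb
          exact absurd hb hx
        · exact ⟨k, h ▸ hb⟩
      · rintro ⟨k, hk⟩
        rcases (R t).rescale_eq_or f b k with h | h
        · rw [h] at hk
          exact absurd hk hx
        · rwa [← h]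
    rw [this]
    exact isOpen_iUnion fun k => hU.preimage (hc k)

/-- A path of configurations induces a homotopy of concatenations. -/
theorem exists_homotopyRel_of_joinedIn (hn : 0 < n) [Nonempty K] {R S : NDomain n K} {F : Set K}
    {f : K → GenLoop (Fin n) X x} (hf : IsKSequence f)
    (h : JoinedIn (boxConf F R.toBoxes) R.toBoxes S.toBoxes) :
    ∃ H : ContinuousMap.HomotopyRel (R.concat f hf).1 (S.concat f hf).1 (Cube.boundary (Fin n)),
      Set.range H ⊆ (⋃ k, Set.range (f k)) ∧
      ∀ t, ∀ k ∈ F, ∀ b ∈ (R.cube k).toSet, H (t, b) = R.concat f hf b := by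
  obtain ⟨γ, hγ⟩ := h
  set Q : I → NDomain n K := fun t => ofBoxes (γ t) (hγ t) with hQ
  have hcont : Continuous fun p : I × (Fin n → I) => (Q p.1).concatFun f p.2 :=
    continuous_concatFun_family Q (fun k => NCube.continuous_rescale_ofBox
      ((continuous_apply k).comp γ.continuous) fun t => (hγ t).1 k) hf
  have hQ0 : Q 0 = R := ofBoxes_eq R γ.source
  have hQ1 : Q 1 = S := ofBoxes_eq S γ.target
  have hcube : ∀ t, ∀ k ∈ F, (Q t).cube k = R.cube k := fun t k hk =>
    NCube.ofBox_eq (hA := (hγ t).1 k) _ ((hγ t).2.2 k hk)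
  refine ⟨⟨⟨⟨fun p => (Q p.1).concatFun f p.2, hcont⟩, fun b => ?_, fun b => ?_⟩,
    fun t b hb => ?_⟩, ?_, fun t k hk b hb => ?_⟩
  · change (Q 0).concatFun f b = R.concatFun f b
    rw [hQ0]
  · change (Q 1).concatFun f b = S.concatFun f b
    rw [hQ1]
  · change (Q t).concatFun f b = R.concatFun f b
    rw [concatFun_of_mem_boundary _ _ hb, concatFun_of_mem_boundary _ _ hb]
  · rintro _ ⟨⟨t, b⟩, rfl⟩
    change (Q t).concatFun f b ∈ _
    rcases (Q t).concatFun_eq_or f b with h | ⟨k, h⟩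
    -- The value `x` lies in the image of any loop, attained on the boundary of the cube.
    · obtain ⟨k⟩ := ‹Nonempty K›
      refine Set.mem_iUnion.2 ⟨k, fun _ => 0, ?_⟩
      rw [h]
      exact GenLoop.boundary (f k) _ ⟨⟨0, hn⟩, Or.inl rfl⟩
    · rw [h]
      exact Set.mem_iUnion.2 ⟨k, _, rfl⟩
  · change (Q t).concatFun f b = R.concatFun f b
    rw [(Q t).concatFun_of_mem f (k := k) (by rwa [hcube t k hk]), R.concatFun_of_mem f hb,
      hcube t k hk]

theorem isPreconnected_boxFree_toBoxes (R : NDomain n K) (F : Finset K)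
    (h : ∀ a ∈ (R.unionOver F)ᶜ, ∀ b ∈ (R.unionOver F)ᶜ, JoinedIn (R.unionOver F)ᶜ a b) :
    IsPreconnected (boxFree (F : Set K) R.toBoxes) := by
  have hmem : ∀ b : Fin n → I, b ∈ (R.unionOver F)ᶜ ↔ ∀ j ∈ (F : Set K),
      ∃ i, (b i : ℝ) < (R.toBoxes j).1 i ∨ (R.toBoxes j).2 i < b i := by
    intro b
    simp only [unionOver, Set.mem_compl_iff, Set.mem_iUnion, not_exists, SetLike.mem_coe]
    refine forall₂_congr fun j _ => ?_
    simp only [NCube.toSet, Set.mem_ofPred_eq, not_forall, toBoxes, NCube.toBox,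
      Subtype.coe_lt_coe]
    refine exists_congr fun i => ?_
    rw [not_and_or, not_le, not_le]
  refine isPreconnected_boxFree F.finite_toSet fun a ha b hb => ?_
  obtain ⟨γ, hγ⟩ := h (fun i => ⟨a i, (ha.1 i).1.le, (ha.1 i).2.le⟩) ((hmem _).2 ha.2)
    (fun i => ⟨b i, (hb.1 i).1.le, (hb.1 i).2.le⟩) ((hmem _).2 hb.2)
  exact ⟨γ.map (f := fun y i => ((y i : I) : ℝ)) (by fun_prop), fun t =>
    ⟨fun i => (γ t i).2, (hmem _).1 (hγ t)⟩⟩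

theorem unionOver_empty (R : NDomain n K) : R.unionOver ∅ = ∅ := by simp [unionOver]

end NDomain

theorem joinedIn_univ_cube {n : ℕ} (a b : Fin n → I) : JoinedIn Set.univ a b :=
  have : PathConnectedSpace I := isPathConnected_iff_pathConnectedSpace.1
    ((convex_Icc 0 1).isPathConnected ⟨0, by simp⟩)
  ⟨Path.pi fun i => (PathConnectedSpace.joined (a i) (b i)).somePath, fun _ => trivial⟩

theorem theorem1 {n : ℕ} (hn : 2 ≤ n) {X : Type*} [TopologicalSpace X] {x : X}
    (K : Set ℕ) (hK : K.Nonempty) (R S : NDomain n K)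
    (f : K → GenLoop (Fin n) X x) (hf : IsKSequence f) :
    (∃ H : ContinuousMap.HomotopyRel (R.concat f hf).1 (S.concat f hf).1 (Cube.boundary (Fin n)),
      Set.range H ⊆ ⋃ k, Set.range (f k)) ∧
    ∀ F : Finset K, (∀ k ∈ F, (R.cube k).toSet = (S.cube k).toSet) →
      (∀ a ∈ (R.unionOver F)ᶜ, ∀ b ∈ (R.unionOver F)ᶜ, JoinedIn (R.unionOver F)ᶜ a b) →
      ∃ H : ContinuousMap.HomotopyRel (R.concat f hf).1 (S.concat f hf).1
          (Cube.boundary (Fin n)),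
        Set.range H ⊆ ⋃ k, Set.range (f k) ∧
        ∀ t, ∀ b ∈ R.unionOver F, H (t, b) = R.concat f hf b := by
  have : Nonempty K := hK.to_subtype
  have main : ∀ F : Finset K, (∀ k ∈ F, (R.cube k).toSet = (S.cube k).toSet) →
      (∀ a ∈ (R.unionOver F)ᶜ, ∀ b ∈ (R.unionOver F)ᶜ, JoinedIn (R.unionOver F)ᶜ a b) →
      ∃ H : ContinuousMap.HomotopyRel (R.concat f hf).1 (S.concat f hf).1
          (Cube.boundary (Fin n)),
        Set.range H ⊆ (⋃ k, Set.range (f k)) ∧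
        ∀ t, ∀ b ∈ R.unionOver F, H (t, b) = R.concat f hf b := by
    intro F hF hjoin
    obtain ⟨H, hrange, hconst⟩ := NDomain.exists_homotopyRel_of_joinedIn (by omega) hf
      (joinedIn_boxConf hn F.finite_toSet (R.toBoxes_mem fun _ _ => rfl)
        (S.toBoxes_mem fun k hk => congrArg NCube.toBox (NCube.toSet_injective (hF k hk)).symm)
        (R.isPreconnected_boxFree_toBoxes F hjoin))
    refine ⟨H, hrange, fun t b hb => ?_⟩
    obtain ⟨k, hk, hbk⟩ := Set.mem_iUnion₂.1 hb
    exact hconst t k hk b hbk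
  refine ⟨?_, main⟩
  -- With no fixed cubes the complement is all of `I^n`, which is path connected.
  obtain ⟨H, hrange, -⟩ := main ∅ (by simp) fun a _ b _ => by
    rw [R.unionOver_empty, Set.compl_empty]
    exact joinedIn_univ_cube a b
  exact ⟨H, hrange⟩
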